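/- Let $(X,d)$ be a compact metric space, $T:X\to X$ a continuous map, and $\mu$ a $T$-invariant Borel probability measure on $X$. For $x,y\in X$, $\delta>0$ and $n\in\mathbb N$, an $(n,\delta)$-match of $x$ and $y$ is an order-preserving bijection $\pi:D\to R$ between subsets $D,R\subseteq\{0,\dots,n-1\}$ such that $d(T^ix,T^{\pi(i)}y)<\delta$ for every $i\in D$; write $|\pi|=|D|$. Put $$\bar f_{n,\delta}(x,y)=1-\frac{\max\{|\pi|:\pi\text{ is an }(n,\delta)\text{-match of }x\text{ and }y\}}{n},\qquad \bar f_\delta(x,y)=\limsup_{n\to\infty}\bar f_{n,\delta}(x,y),$$ $$d_{FK}(x,y)=\inf\{\delta>0:\bar f_\delta(x,y)<\delta\}.$$ For two words $u=u_0\dots u_{n-1}$ and $v=v_0\dots v_{n-1}$ over a finite alphabet let $\bar f_n(u,v)=1-\frac kn$, where $k$ is the largest integer for which there are $0\le i_1<\dots<i_k\le n-1$ and $0\le j_1<\dots<j_k\le n-1$ with $u_{i_s}=v_{j_s}$ for $s=1,\dots,k$. For a finite Borel partition $\mathcal P$ of $X$, let $\mathcal P^n$ denote the set of words of length $n$ over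 the alphabet $\mathcal P$; identify $w=(w_0,\dots,w_{n-1})\in\mathcal P^n$ with the set $\bigcap_{i=0}^{n-1}T^{-i}w_i$, and a set of words with the union of the corresponding sets. Then the following statements are equivalent: 1. $(\mu\times\mu)(\{(x,y)\in X\times X: d_{FK}(x,y)=0\})=1$. 2. There exists a Borel set $M\subseteq X$ with $\mu(M)=1$ such that $d_{FK}(x,y)=0$ for all $x,y\in M$. 3. For every finite Borel partition $\mathcal P$ of $X$ and every $\varepsilon>0$ there exists $N$ such that for every $n>N$ there exists a word $w\in\mathcal P^n$ with $\mu(\{w'\in\mathcal P^n:\bar f_n(w,w')<\varepsilon\})\ge 1-\varepsilon$. Moreover, each one of (1), (2), (3) implies that $\mu$ is ergodic for $T$. -/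

import Mathlib

open MeasureTheory Filter

noncomputable section

namespace FeldmanKatok

/-- `π` is an `(n, δ)`-match of `x` and `y`: an order preserving bijection between two subsets
`D`, `R` of `{0, …, n - 1}` with `d(T^i x, T^{π(i)} y) < δ` for all `i ∈ D`. -/
def IsMatch {X : Type*} [MetricSpace X] (T : X → X) (n : ℕ) (δ : ℝ) (x y : X)
    {D R : Finset ℕ} (π : D ≃o R) : Prop :=
  D ⊆ Finset.range n ∧ R ⊆ Finset.range n ∧
    ∀ i : D, dist (T^[(i : ℕ)] x) (T^[(π i : ℕ)] y) < δ

/-- The largest cardinality `|π| = |D(π)|` of an `(n, δ)`-match of `x` and `y`. -/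
def maxMatch {X : Type*} [MetricSpace X] (T : X → X) (n : ℕ) (δ : ℝ) (x y : X) : ℕ :=
  sSup {m : ℕ | ∃ (D R : Finset ℕ) (π : D ≃o R), IsMatch T n δ x y π ∧ D.card = m}

/-- The supremum defining `maxMatch` is attained, so it is a maximum. -/
theorem maxMatch_isGreatest {X : Type*} [MetricSpace X] (T : X → X) (n : ℕ) (δ : ℝ) (x y : X) :
    IsGreatest {m : ℕ | ∃ (D R : Finset ℕ) (π : D ≃o R), IsMatch T n δ x y π ∧ D.card = m}
      (maxMatch T n δ x y) := by
  have hb : BddAbove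
      {m : ℕ | ∃ (D R : Finset ℕ) (π : D ≃o R), IsMatch T n δ x y π ∧ D.card = m} := by
    refine ⟨n, ?_⟩
    rintro m ⟨D, R, π, h, rfl⟩
    simpa using Finset.card_le_card h.1
  refine ⟨Nat.sSup_mem ⟨0, ∅, ∅, OrderIso.refl _, ⟨by simp, by simp, ?_⟩, by simp⟩ hb,
    fun m hm => le_csSup hb hm⟩
  rintro ⟨i, hi⟩
  simp at hi

/-- `f̄_{n,δ}(x, y) = 1 - max |π| / n`. -/
def fBarN {X : Type*} [MetricSpace X] (T : X → X) (n : ℕ) (δ : ℝ) (x y : X) : ℝ :=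
  1 - (maxMatch T n δ x y : ℝ) / n

/-- `f̄_δ(x, y) = limsup_n f̄_{n,δ}(x, y)`; the sequence takes values in `[0, 1]`. -/
def fBar {X : Type*} [MetricSpace X] (T : X → X) (δ : ℝ) (x y : X) : ℝ :=
  limsup (fun n : ℕ => fBarN T n δ x y) atTop

/-- The Feldman-Katok pseudometric `d_FK`. -/
def dFK {X : Type*} [MetricSpace X] (T : X → X) (x y : X) : ℝ :=
  sInf {δ : ℝ | 0 < δ ∧ fBar T δ x y < δ}

/-- The largest length of a common subsequence of the words `u` and `v` of length `n`. -/
def maxCommon {α : Type*} {n : ℕ} (u v : Fin n → α) : ℕ :=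
  sSup {k : ℕ | ∃ i j : Fin k → Fin n, StrictMono i ∧ StrictMono j ∧ ∀ s, u (i s) = v (j s)}

/-- The supremum defining `maxCommon` is attained, so it is a maximum. -/
theorem maxCommon_isGreatest {α : Type*} {n : ℕ} (u v : Fin n → α) :
    IsGreatest
      {k : ℕ | ∃ i j : Fin k → Fin n, StrictMono i ∧ StrictMono j ∧ ∀ s, u (i s) = v (j s)}
      (maxCommon u v) := by
  have hb : BddAbove
      {k : ℕ | ∃ i j : Fin k → Fin n, StrictMono i ∧ StrictMono j ∧ ∀ s, u (i s) = v (j s)} := by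
    refine ⟨n, ?_⟩
    rintro k ⟨i, j, hi, -, -⟩
    simpa using Fintype.card_le_of_injective i hi.injective
  exact ⟨Nat.sSup_mem ⟨0, Fin.elim0, Fin.elim0, fun a => a.elim0, fun a => a.elim0,
    fun a => a.elim0⟩ hb, fun k hk => le_csSup hb hk⟩

/-- The edit distance `f̄_n(u, v) = 1 - k / n` of two words of length `n`. -/
def editDist {α : Type*} {n : ℕ} (u v : Fin n → α) : ℝ :=
  1 - (maxCommon u v : ℝ) / n

/-- The set `⋂_{i < n} T^{-i} w_i` of the points whose `n`-name along the partition `P` is `w`. -/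
def cylinder {X : Type*} (T : X → X) (P : Finpartition (Set.univ : Set X)) {n : ℕ}
    (w : Fin n → P.parts) : Set X :=
  ⋂ i : Fin n, T^[(i : ℕ)] ⁻¹' (w i : Set X)

/-- Katok's condition: for every finite measurable partition `P` and every `ε > 0`, for all large
`n` there is a word `w` of length `n` over `P` such that the words `w'` with `f̄_n(w, w') < ε`
carry together measure at least `1 - ε`. -/
def KatokCondition {X : Type*} [MeasurableSpace X] (T : X → X) (μ : Measure X) : Prop :=
  ∀ P : Finpartition (Set.univ : Set X), (∀ A ∈ P.parts, MeasurableSet A) →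
    ∀ ε : ℝ, 0 < ε → ∃ N : ℕ, ∀ n : ℕ, N < n → ∃ w : Fin n → P.parts,
      1 - ε ≤ μ.real (⋃ w' ∈ {w' : Fin n → P.parts | editDist w w' < ε}, cylinder T P w')

end FeldmanKatok

end

/-! The implications run 1 → 2 → 3 → 1, and ergodicity is read off from 3. Matches of orbits and
common subsequences of words are both order-preserving sets of index pairs, so composition (a
triangle inequality), concatenation and deletion are proved once, for `matchNum`.

1 → 2 is Fubini: for some `x`, almost every `y` has `dFK T x y = 0`, and the zero relation is
symmetric and transitive.

2 → 3: fix `x₀` in `M`. Outside a set of small measure, from a uniform time on, `y` matches `x₀`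
almost fully, and its orbit rarely leaves a compact set `K` on which nearby points lie in the same
cell (`exists_isCompact_partOf_eq`). For two such points, composing their matches through `x₀` and
deleting the exits from `K` leaves a long common subsequence of names.

3 → 1: a partition of small mesh gives one length `n₀` at which `fBarN` has small integral over
`μ.prod μ`. Concatenating blocks bounds `fBarN` at large `n`, up to a remainder, by Birkhoff
averages along `(T × T)^{n₀}`. The maximal inequality `mul_measureReal_exists_lt_birkhoffSum_le`
controls these averages almost everywhere; no ergodicity of the product is needed.

Ergodicity: for an invariant set `A`, names along `{A, Aᶜ}` are constant, so points of `A` and of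
`Aᶜ` have names at edit distance 1. -/

namespace FeldmanKatok

/-! ### Order-preserving matches as finite sets of pairs -/

/-- A finite set `S` of pairs is the graph of an order preserving bijection between two subsets of
`{0, …, n - 1}` whose pairs are all related by `r`. -/
def IsOrderMatch (r : ℕ → ℕ → Prop) (n : ℕ) (S : Finset (ℕ × ℕ)) : Prop :=
  (∀ p ∈ S, p.1 < n ∧ p.2 < n ∧ r p.1 p.2) ∧ ∀ p ∈ S, ∀ q ∈ S, p.1 < q.1 ↔ p.2 < q.2

namespace IsOrderMatch

variable {r r' : ℕ → ℕ → Prop} {n m : ℕ} {S S' : Finset (ℕ × ℕ)}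

theorem empty (r : ℕ → ℕ → Prop) (n : ℕ) : IsOrderMatch r n ∅ := by
  simp [IsOrderMatch]

theorem subset (h : IsOrderMatch r n S) (hS : S' ⊆ S) : IsOrderMatch r n S' :=
  ⟨fun p hp => h.1 p (hS hp), fun p hp q hq => h.2 p (hS hp) q (hS hq)⟩

theorem fst_eq_iff (h : IsOrderMatch r n S) {p q : ℕ × ℕ} (hp : p ∈ S) (hq : q ∈ S) :
    p.1 = q.1 ↔ p.2 = q.2 := by
  have h1 := h.2 p hp q hq
  have h2 := h.2 q hq p hp
  omega

theorem injOn_fst (h : IsOrderMatch r n S) : Set.InjOn Prod.fst (S : Set (ℕ × ℕ)) :=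
  fun _ hp _ hq hpq => Prod.ext hpq ((h.fst_eq_iff hp hq).1 hpq)

theorem injOn_snd (h : IsOrderMatch r n S) : Set.InjOn Prod.snd (S : Set (ℕ × ℕ)) :=
  fun _ hp _ hq hpq => Prod.ext ((h.fst_eq_iff hp hq).2 hpq) hpq

theorem card_image_fst (h : IsOrderMatch r n S) : (S.image Prod.fst).card = S.card :=
  Finset.card_image_of_injOn h.injOn_fst

theorem card_image_snd (h : IsOrderMatch r n S) : (S.image Prod.snd).card = S.card :=
  Finset.card_image_of_injOn h.injOn_snd

theorem image_fst_subset (h : IsOrderMatch r n S) : S.image Prod.fst ⊆ Finset.range n := by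
  intro a ha
  obtain ⟨p, hp, rfl⟩ := Finset.mem_image.1 ha
  exact Finset.mem_range.2 (h.1 p hp).1

theorem image_snd_subset (h : IsOrderMatch r n S) : S.image Prod.snd ⊆ Finset.range n := by
  intro a ha
  obtain ⟨p, hp, rfl⟩ := Finset.mem_image.1 ha
  exact Finset.mem_range.2 (h.1 p hp).2.1

theorem card_le (h : IsOrderMatch r n S) : S.card ≤ n := by
  rw [← h.card_image_fst]
  simpa using Finset.card_le_card h.image_fst_subset

/-- The order isomorphism whose graph is a given order preserving match. -/
theorem exists_orderIso (h : IsOrderMatch r n S) :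
    ∃ π : S.image Prod.fst ≃o S.image Prod.snd,
      ∀ i : S.image Prod.fst, ((i : ℕ), (π i : ℕ)) ∈ S := by
  have key : ∀ i : S.image Prod.fst, ∃ j : S.image Prod.snd, ((i : ℕ), (j : ℕ)) ∈ S := by
    rintro ⟨i, hi⟩
    obtain ⟨p, hp, rfl⟩ := Finset.mem_image.1 hi
    exact ⟨⟨p.2, Finset.mem_image_of_mem _ hp⟩, hp⟩
  choose f hf using key
  have hmono : StrictMono f := fun a b hab => (h.2 _ (hf a) _ (hf b)).1 hab
  have hsurj : Function.Surjective f := by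
    rintro ⟨j, hj⟩
    obtain ⟨p, hp, rfl⟩ := Finset.mem_image.1 hj
    refine ⟨⟨p.1, Finset.mem_image_of_mem _ hp⟩, Subtype.ext ?_⟩
    exact (h.fst_eq_iff (hf _) hp).1 rfl
  exact ⟨StrictMono.orderIsoOfSurjective f hmono hsurj, hf⟩

/-- Two order preserving matches can be composed, losing at most as many pairs as each of them
misses. -/
theorem exists_comp (h : IsOrderMatch r n S) (h' : IsOrderMatch r' n S') :
    ∃ U, IsOrderMatch (fun a c => ∃ b, r a b ∧ r' b c) n U ∧ S.card + S'.card ≤ U.card + n := by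
  classical
  -- `B` holds the middle indices used by both matches. Inclusion-exclusion inside `{0, …, n - 1}`
  -- bounds its size from below.
  let B := S.image Prod.snd ∩ S'.image Prod.fst
  have key : ∀ b : ℕ, ∃ p : ℕ × ℕ, b ∈ B → (p.1, b) ∈ S ∧ (b, p.2) ∈ S' := by
    intro b
    by_cases hb : b ∈ B
    · obtain ⟨h1, h2⟩ := Finset.mem_inter.1 hb
      obtain ⟨p, hp, rfl⟩ := Finset.mem_image.1 h1
      obtain ⟨q, hq, hqp⟩ := Finset.mem_image.1 h2
      exact ⟨(p.1, q.2), fun _ => ⟨hp, by rw [← hqp]; exact hq⟩⟩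
    · exact ⟨(0, 0), fun hb' => absurd hb' hb⟩
  choose f hf using key
  have hcard : B.card + n ≥ S.card + S'.card := by
    have h1 := Finset.card_union_add_card_inter (S.image Prod.snd) (S'.image Prod.fst)
    rw [h.card_image_snd, h'.card_image_fst] at h1
    have h2 : (S.image Prod.snd ∪ S'.image Prod.fst).card ≤ n := by
      simpa using
        Finset.card_le_card (Finset.union_subset h.image_snd_subset h'.image_fst_subset)
    change _ + B.card = _ at h1
    omega
  have hinj : Set.InjOn f (B : Set ℕ) := by
    intro b hb c hc hbc
    have := (h.fst_eq_iff (hf b hb).1 (hf c hc).1).1 (by simp [hbc])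
    exact this
  refine ⟨B.image f, ⟨?_, ?_⟩, ?_⟩
  · intro p hp
    obtain ⟨b, hb, rfl⟩ := Finset.mem_image.1 hp
    have h1 := h.1 _ (hf b hb).1
    have h2 := h'.1 _ (hf b hb).2
    exact ⟨h1.1, h2.2.1, b, h1.2.2, h2.2.2⟩
  · intro p hp q hq
    obtain ⟨b, hb, rfl⟩ := Finset.mem_image.1 hp
    obtain ⟨c, hc, rfl⟩ := Finset.mem_image.1 hq
    exact (h.2 _ (hf b hb).1 _ (hf c hc).1).trans (h'.2 _ (hf b hb).2 _ (hf c hc).2)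
  · rw [Finset.card_image_of_injOn hinj]
    omega

theorem exists_swap (h : IsOrderMatch r n S) :
    ∃ U, IsOrderMatch (fun a b => r b a) n U ∧ U.card = S.card := by
  refine ⟨S.map (Equiv.prodComm ℕ ℕ).toEmbedding, ⟨?_, ?_⟩, Finset.card_map _⟩
  · intro p hp
    obtain ⟨q, hq, rfl⟩ := Finset.mem_map.1 hp
    have := h.1 q hq
    exact ⟨this.2.1, this.1, this.2.2⟩
  · intro p hp q hq
    obtain ⟨p', hp', rfl⟩ := Finset.mem_map.1 hp
    obtain ⟨q', hq', rfl⟩ := Finset.mem_map.1 hq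
    exact (h.2 p' hp' q' hq').symm

/-- Concatenation of order preserving matches. -/
theorem exists_add (h : IsOrderMatch r n S)
    (h' : IsOrderMatch (fun a b => r (a + n) (b + n)) m S') :
    ∃ U, IsOrderMatch r (n + m) U ∧ U.card = S.card + S'.card := by
  classical
  let e : ℕ × ℕ ↪ ℕ × ℕ := (addRightEmbedding n).prodMap (addRightEmbedding n)
  have he : ∀ p ∈ S'.map e, ∃ q ∈ S', p.1 = q.1 + n ∧ p.2 = q.2 + n := by
    intro p hp
    obtain ⟨q, hq, rfl⟩ := Finset.mem_map.1 hp
    exact ⟨q, hq, rfl, rfl⟩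
  refine ⟨S ∪ S'.map e, ⟨?_, ?_⟩, ?_⟩
  · intro p hp
    rcases Finset.mem_union.1 hp with hp | hp
    · have := h.1 p hp
      exact ⟨by omega, by omega, this.2.2⟩
    · obtain ⟨q, hq, h1, h2⟩ := he p hp
      have := h'.1 q hq
      rw [h1, h2]
      exact ⟨by omega, by omega, this.2.2⟩
  · intro p hp q hq
    rcases Finset.mem_union.1 hp with hp | hp <;> rcases Finset.mem_union.1 hq with hq | hq
    · exact h.2 p hp q hq
    -- Mixed case: pairs of the first block have both coordinates below `n`, shifted pairs have both
    -- at least `n`.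
    · obtain ⟨q', hq', h1, h2⟩ := he q hq
      have := h.1 p hp
      omega
    · obtain ⟨p', hp', h1, h2⟩ := he p hp
      have := h.1 q hq
      omega
    · obtain ⟨q', hq', h1, h2⟩ := he q hq
      obtain ⟨p', hp', h3, h4⟩ := he p hp
      have := h'.2 p' hp' q' hq'
      omega
  · rw [Finset.card_union_of_disjoint, Finset.card_map]
    refine Finset.disjoint_left.2 fun p hp hp' => ?_
    obtain ⟨q, -, h1, -⟩ := he p hp'
    have := h.1 p hp
    omega

/-- Deleting the pairs with a coordinate outside prescribed sets of indices. -/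
theorem exists_restrict (h : IsOrderMatch r n S) (A B : ℕ → Prop) [DecidablePred A]
    [DecidablePred B] :
    ∃ U, IsOrderMatch (fun a b => r a b ∧ A a ∧ B b) n U ∧
      S.card ≤ U.card + ((Finset.range n).filter fun i => ¬ A i).card +
        ((Finset.range n).filter fun i => ¬ B i).card := by
  classical
  have hU : IsOrderMatch r n (S.filter fun p => A p.1 ∧ B p.2) := h.subset (Finset.filter_subset _ _)
  refine ⟨S.filter fun p => A p.1 ∧ B p.2, ⟨fun p hp => ?_, hU.2⟩, ?_⟩
  · have := hU.1 p hp
    exact ⟨this.1, this.2.1, this.2.2, (Finset.mem_filter.1 hp).2⟩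
  · have h1 : (S.filter fun p => ¬ A p.1).card ≤ ((Finset.range n).filter fun i => ¬ A i).card := by
      refine Finset.card_le_card_of_injOn Prod.fst ?_
        (h.injOn_fst.mono (by simp [Set.subset_def]; tauto))
      intro p hp
      have hp := Finset.mem_filter.1 hp
      exact Finset.mem_filter.2 ⟨Finset.mem_range.2 (h.1 p hp.1).1, hp.2⟩
    have h2 : (S.filter fun p => ¬ B p.2).card ≤ ((Finset.range n).filter fun i => ¬ B i).card := by
      refine Finset.card_le_card_of_injOn Prod.snd ?_
        (h.injOn_snd.mono (by simp [Set.subset_def]; tauto))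
      intro p hp
      have hp := Finset.mem_filter.1 hp
      exact Finset.mem_filter.2 ⟨Finset.mem_range.2 (h.1 p hp.1).2.1, hp.2⟩
    have h3 : S ⊆ (S.filter fun p => A p.1 ∧ B p.2) ∪ (S.filter fun p => ¬ A p.1) ∪
        (S.filter fun p => ¬ B p.2) := by
      intro p hp
      simp only [Finset.mem_union, Finset.mem_filter, hp, true_and]
      tauto
    have h4 := Finset.card_le_card h3
    have h5 := Finset.card_union_le ((S.filter fun p => A p.1 ∧ B p.2) ∪ (S.filter fun p => ¬ A p.1))
      (S.filter fun p => ¬ B p.2)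
    have h6 := Finset.card_union_le (S.filter fun p => A p.1 ∧ B p.2) (S.filter fun p => ¬ A p.1)
    omega

end IsOrderMatch

/-! ### The maximal size of a match -/

/-- The largest size of an order preserving match along `r` inside `{0, …, n - 1}`. -/
noncomputable def matchNum (r : ℕ → ℕ → Prop) (n : ℕ) : ℕ :=
  sSup {k | ∃ S, IsOrderMatch r n S ∧ S.card = k}

section matchNum

variable {r r' r'' : ℕ → ℕ → Prop} {n m : ℕ}

theorem bddAbove_card_isOrderMatch (r : ℕ → ℕ → Prop) (n : ℕ) :
    BddAbove {k | ∃ S, IsOrderMatch r n S ∧ S.card = k} :=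
  ⟨n, fun _ ⟨_, hS, hk⟩ => hk ▸ hS.card_le⟩

theorem IsOrderMatch.card_le_matchNum {S : Finset (ℕ × ℕ)} (h : IsOrderMatch r n S) :
    S.card ≤ matchNum r n :=
  le_csSup (bddAbove_card_isOrderMatch r n) ⟨S, h, rfl⟩

theorem exists_card_eq_matchNum (r : ℕ → ℕ → Prop) (n : ℕ) :
    ∃ S, IsOrderMatch r n S ∧ S.card = matchNum r n :=
  Nat.sSup_mem (s := {k | ∃ S, IsOrderMatch r n S ∧ S.card = k})
    ⟨0, ∅, IsOrderMatch.empty r n, rfl⟩ (bddAbove_card_isOrderMatch r n)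

theorem matchNum_le (r : ℕ → ℕ → Prop) (n : ℕ) : matchNum r n ≤ n := by
  obtain ⟨S, hS, h⟩ := exists_card_eq_matchNum r n
  exact h ▸ hS.card_le

theorem matchNum_mono (hnm : n ≤ m) (h : ∀ a < n, ∀ b < n, r a b → r' a b) :
    matchNum r n ≤ matchNum r' m := by
  obtain ⟨S, hS, hc⟩ := exists_card_eq_matchNum r n
  rw [← hc]
  refine IsOrderMatch.card_le_matchNum ⟨fun p hp => ?_, hS.2⟩
  have := hS.1 p hp
  exact ⟨this.1.trans_le hnm, this.2.1.trans_le hnm, h _ this.1 _ this.2.1 this.2.2⟩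

theorem matchNum_swap (r : ℕ → ℕ → Prop) (n : ℕ) :
    matchNum r n ≤ matchNum (fun a b => r b a) n := by
  obtain ⟨S, hS, hc⟩ := exists_card_eq_matchNum r n
  obtain ⟨U, hU, h⟩ := hS.exists_swap
  rw [← hc, ← h]
  exact hU.card_le_matchNum

theorem matchNum_comp (h : ∀ a < n, ∀ c < n, ∀ b, r a b → r' b c → r'' a c) :
    matchNum r n + matchNum r' n ≤ matchNum r'' n + n := by
  obtain ⟨S, hS, hc⟩ := exists_card_eq_matchNum r n
  obtain ⟨S', hS', hc'⟩ := exists_card_eq_matchNum r' n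
  obtain ⟨U, hU, hle⟩ := hS.exists_comp hS'
  have h1 := hU.card_le_matchNum
  have h2 : matchNum (fun a c => ∃ b, r a b ∧ r' b c) n ≤ matchNum r'' n :=
    matchNum_mono le_rfl fun a ha c hc ⟨b, hab, hbc⟩ => h a ha c hc b hab hbc
  omega

theorem matchNum_add (r : ℕ → ℕ → Prop) (n m : ℕ) :
    matchNum r n + matchNum (fun a b => r (a + n) (b + n)) m ≤ matchNum r (n + m) := by
  obtain ⟨S, hS, hc⟩ := exists_card_eq_matchNum r n
  obtain ⟨S', hS', hc'⟩ := exists_card_eq_matchNum (fun a b => r (a + n) (b + n)) m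
  obtain ⟨U, hU, h⟩ := hS.exists_add hS'
  rw [← hc, ← hc', ← h]
  exact hU.card_le_matchNum

theorem matchNum_restrict (r : ℕ → ℕ → Prop) (n : ℕ) (A B : ℕ → Prop) [DecidablePred A]
    [DecidablePred B] :
    matchNum r n ≤ matchNum (fun a b => r a b ∧ A a ∧ B b) n +
      ((Finset.range n).filter fun i => ¬ A i).card +
        ((Finset.range n).filter fun i => ¬ B i).card := by
  obtain ⟨S, hS, hc⟩ := exists_card_eq_matchNum r n
  obtain ⟨U, hU, h⟩ := hS.exists_restrict A B
  have := hU.card_le_matchNum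
  omega

end matchNum

/-- The graph of an order isomorphism is an order match, and conversely; the lemmas on `matchNum`
thus apply to orbits. -/
theorem maxMatch_eq_matchNum {X : Type*} [MetricSpace X] (T : X → X) (n : ℕ) (δ : ℝ) (x y : X) :
    maxMatch T n δ x y = matchNum (fun a b => dist (T^[a] x) (T^[b] y) < δ) n := by
  unfold maxMatch matchNum
  congr 1
  ext k
  constructor
  · rintro ⟨D, R, π, ⟨hD, hR, hπ⟩, rfl⟩
    refine ⟨Finset.univ.map
      ⟨fun i : D => ((i : ℕ), (π i : ℕ)), fun i j h => Subtype.ext (Prod.mk.inj h).1⟩,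
      ⟨?_, ?_⟩, by simp⟩
    · intro p hp
      obtain ⟨i, -, rfl⟩ := Finset.mem_map.1 hp
      exact ⟨Finset.mem_range.1 (hD i.2), Finset.mem_range.1 (hR (π i).2), hπ i⟩
    · intro p hp q hq
      obtain ⟨i, -, rfl⟩ := Finset.mem_map.1 hp
      obtain ⟨j, -, rfl⟩ := Finset.mem_map.1 hq
      exact (π.lt_iff_lt (x := i) (y := j)).symm
  · rintro ⟨S, hS, rfl⟩
    obtain ⟨π, hπ⟩ := hS.exists_orderIso
    exact ⟨_, _, π, ⟨hS.image_fst_subset, hS.image_snd_subset, fun i => (hS.1 _ (hπ i)).2.2⟩,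
      hS.card_image_fst⟩

theorem maxCommon_eq_matchNum {α : Type*} {n : ℕ} (u v : Fin n → α) :
    maxCommon u v =
      matchNum (fun a b => ∃ (ha : a < n) (hb : b < n), u ⟨a, ha⟩ = v ⟨b, hb⟩) n := by
  unfold maxCommon matchNum
  congr 1
  ext k
  constructor
  · rintro ⟨i, j, hi, hj, h⟩
    refine ⟨Finset.univ.map
      ⟨fun s : Fin k => ((i s : ℕ), (j s : ℕ)),
        fun s t h => hi.injective (Fin.ext (Prod.mk.inj h).1)⟩, ⟨?_, ?_⟩, by simp⟩
    · intro p hp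
      obtain ⟨s, -, rfl⟩ := Finset.mem_map.1 hp
      exact ⟨(i s).2, (j s).2, (i s).2, (j s).2, h s⟩
    · intro p hp q hq
      obtain ⟨s, -, rfl⟩ := Finset.mem_map.1 hp
      obtain ⟨t, -, rfl⟩ := Finset.mem_map.1 hq
      exact (hi.lt_iff_lt (a := s) (b := t)).trans (hj.lt_iff_lt (a := s) (b := t)).symm
  · rintro ⟨S, hS, rfl⟩
    obtain ⟨π, hπ⟩ := hS.exists_orderIso
    let e := (S.image Prod.fst).orderIsoOfFin hS.card_image_fst
    have h := fun s => hS.1 _ (hπ (e s))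
    refine ⟨fun s => ⟨e s, (h s).1⟩, fun s => ⟨π (e s), (h s).2.1⟩, fun s t hst => ?_,
      fun s t hst => ?_, fun s => ?_⟩
    · exact e.strictMono hst
    · exact π.strictMono (e.strictMono hst)
    · obtain ⟨_, _, h1⟩ := (h s).2.2
      exact h1

/-! ### The relation of zero Feldman-Katok distance and its measurability -/

section FeldmanKatokPseudometric

variable {X : Type*} [MetricSpace X] {T : X → X}

theorem maxMatch_mono {n m : ℕ} {δ δ' : ℝ} (hnm : n ≤ m) (h : δ ≤ δ') (x y : X) :
    maxMatch T n δ x y ≤ maxMatch T m δ' x y := by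
  simp only [maxMatch_eq_matchNum]
  exact matchNum_mono hnm fun a _ b _ hab => hab.trans_le h

theorem maxMatch_le (T : X → X) (n : ℕ) (δ : ℝ) (x y : X) : maxMatch T n δ x y ≤ n := by
  rw [maxMatch_eq_matchNum]
  exact matchNum_le _ _

theorem maxMatch_comm (T : X → X) (n : ℕ) (δ : ℝ) (x y : X) :
    maxMatch T n δ x y = maxMatch T n δ y x := by
  have key : ∀ x y : X, maxMatch T n δ x y ≤ maxMatch T n δ y x := by
    intro x y
    simp only [maxMatch_eq_matchNum]
    refine (matchNum_swap _ n).trans (matchNum_mono le_rfl fun a _ b _ hab => ?_)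
    rwa [dist_comm]
  exact (key x y).antisymm (key y x)

theorem maxMatch_triangle (T : X → X) (n : ℕ) (δ δ' : ℝ) (x y z : X) :
    maxMatch T n δ x y + maxMatch T n δ' y z ≤ maxMatch T n (δ + δ') x z + n := by
  simp only [maxMatch_eq_matchNum]
  exact matchNum_comp fun a _ c _ b hab hbc =>
    (dist_triangle _ (T^[b] y) _).trans_lt (add_lt_add hab hbc)

theorem maxMatch_add (T : X → X) (n m : ℕ) (δ : ℝ) (x y : X) :
    maxMatch T n δ x y + maxMatch T m δ (T^[n] x) (T^[n] y) ≤ maxMatch T (n + m) δ x y := by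
  simp only [maxMatch_eq_matchNum, ← Function.iterate_add_apply]
  exact matchNum_add _ n m

theorem sum_maxMatch_le (T : X → X) (n q : ℕ) (δ : ℝ) (x y : X) :
    ∑ j ∈ Finset.range q, maxMatch T n δ (T^[n * j] x) (T^[n * j] y) ≤
      maxMatch T (n * q) δ x y := by
  induction q with
  | zero => simp
  | succ q ih =>
    rw [Finset.sum_range_succ, Nat.mul_succ]
    exact (Nat.add_le_add_right ih _).trans (maxMatch_add T _ _ δ x y)

theorem fBarN_nonneg (T : X → X) (n : ℕ) (δ : ℝ) (x y : X) : 0 ≤ fBarN T n δ x y := by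
  have h : (maxMatch T n δ x y : ℝ) ≤ n := by exact_mod_cast maxMatch_le T n δ x y
  exact sub_nonneg.2 (div_le_one_of_le₀ h n.cast_nonneg)

theorem fBarN_le_one (T : X → X) (n : ℕ) (δ : ℝ) (x y : X) : fBarN T n δ x y ≤ 1 := by
  unfold fBarN
  have : (0 : ℝ) ≤ (maxMatch T n δ x y : ℝ) / n := by positivity
  linarith

theorem fBarN_anti (T : X → X) (n : ℕ) {δ δ' : ℝ} (h : δ ≤ δ') (x y : X) :
    fBarN T n δ' x y ≤ fBarN T n δ x y := by
  unfold fBarN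
  have : (maxMatch T n δ x y : ℝ) ≤ maxMatch T n δ' x y := by
    exact_mod_cast maxMatch_mono le_rfl h x y
  gcongr

theorem fBarN_le_iff {n : ℕ} (hn : 0 < n) {δ ε : ℝ} {x y : X} :
    fBarN T n δ x y ≤ ε ↔ (1 - ε) * n ≤ maxMatch T n δ x y := by
  have hn' : (0 : ℝ) < n := by exact_mod_cast hn
  rw [← le_div_iff₀ hn', fBarN]
  constructor <;> intro h <;> linarith

theorem mul_fBarN (T : X → X) (n : ℕ) (δ : ℝ) (x y : X) :
    n * fBarN T n δ x y = n - maxMatch T n δ x y := by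
  rcases Nat.eq_zero_or_pos n with rfl | hn
  · have := maxMatch_le T 0 δ x y
    simp only [Nat.le_zero] at this
    simp [this]
  · have hn' : (n : ℝ) ≠ 0 := by exact_mod_cast hn.ne'
    rw [fBarN]
    field_simp

theorem isBoundedUnder_fBarN (T : X → X) (δ : ℝ) (x y : X) :
    IsBoundedUnder (· ≤ ·) atTop fun n : ℕ => fBarN T n δ x y :=
  isBoundedUnder_of ⟨1, fun n => fBarN_le_one T n δ x y⟩

theorem isCoboundedUnder_fBarN (T : X → X) (δ : ℝ) (x y : X) :
    IsCoboundedUnder (· ≤ ·) atTop fun n : ℕ => fBarN T n δ x y :=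
  (isBoundedUnder_of ⟨0, fun n => fBarN_nonneg T n δ x y⟩ :
    IsBoundedUnder (· ≥ ·) atTop fun n : ℕ => fBarN T n δ x y).isCoboundedUnder_le

theorem fBar_anti (T : X → X) {δ δ' : ℝ} (h : δ ≤ δ') (x y : X) :
    fBar T δ' x y ≤ fBar T δ x y :=
  limsup_le_limsup (Eventually.of_forall fun n => fBarN_anti T n h x y)
    (isCoboundedUnder_fBarN T δ' x y) (isBoundedUnder_fBarN T δ x y)

/-- Since `fBar` decreases in `δ`, a zero infimum forces `fBar T δ x y < δ` at every scale. This
removes both the `sInf` and the `limsup` from later arguments. -/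
theorem dFK_eq_zero_iff {x y : X} :
    dFK T x y = 0 ↔
      ∀ δ : ℝ, 0 < δ → ∀ᶠ n : ℕ in atTop, (1 - δ) * n ≤ maxMatch T n δ x y := by
  constructor
  · intro h δ hδ
    have hne : {δ : ℝ | 0 < δ ∧ fBar T δ x y < δ}.Nonempty := by
      refine ⟨2, two_pos, ?_⟩
      have : fBar T 2 x y ≤ 1 := limsup_le_of_le (isCoboundedUnder_fBarN T 2 x y)
        (Eventually.of_forall fun n => fBarN_le_one T n 2 x y)
      linarith
    obtain ⟨δ', ⟨-, h2⟩, h3⟩ := exists_lt_of_csInf_lt hne (show dFK T x y < δ by rwa [h])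
    have h4 : fBar T δ x y < δ := ((fBar_anti T h3.le x y).trans_lt h2).trans h3
    filter_upwards [eventually_lt_of_limsup_lt h4 (isBoundedUnder_fBarN T δ x y),
      eventually_gt_atTop 0] with n hn hn0
    exact (fBarN_le_iff hn0).1 hn.le
  · intro h
    refine le_antisymm (le_of_forall_pos_le_add fun δ hδ => ?_)
      (Real.sInf_nonneg fun δ hδ => hδ.1.le)
    -- Halving the scale recovers the strict inequality, as the `limsup` bound is only weak.
    have h1 : fBar T (δ / 2) x y ≤ δ / 2 := by
      refine limsup_le_of_le (isCoboundedUnder_fBarN T _ x y) ?_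
      filter_upwards [h (δ / 2) (half_pos hδ), eventually_gt_atTop 0] with n hn hn0
      exact (fBarN_le_iff hn0).2 hn
    have h2 := fBar_anti T (half_le_self hδ.le) x y
    rw [zero_add]
    exact csInf_le ⟨0, fun δ hδ => hδ.1.le⟩ ⟨hδ, by linarith⟩

/-- Countably many scales suffice; this serves measurability and almost-everywhere statements. -/
theorem dFK_eq_zero_iff_nat {x y : X} :
    dFK T x y = 0 ↔ ∀ m : ℕ, ∀ᶠ n : ℕ in atTop,
      (1 - 1 / ((m : ℝ) + 1)) * n ≤ maxMatch T n (1 / ((m : ℝ) + 1)) x y := by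
  rw [dFK_eq_zero_iff]
  constructor
  · exact fun h m => h _ (by positivity)
  · intro h δ hδ
    obtain ⟨m, hm⟩ := exists_nat_one_div_lt hδ
    filter_upwards [h m] with n hn
    have h1 : (maxMatch T n (1 / ((m : ℝ) + 1)) x y : ℝ) ≤ maxMatch T n δ x y := by
      exact_mod_cast maxMatch_mono le_rfl hm.le x y
    have h2 : (1 - δ) * (n : ℝ) ≤ (1 - 1 / ((m : ℝ) + 1)) * n := by gcongr
    linarith

theorem dFK_eq_zero_symm {x y : X} (h : dFK T x y = 0) : dFK T y x = 0 := by
  rw [dFK_eq_zero_iff] at h ⊢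
  simpa only [maxMatch_comm T _ _ y x] using h

theorem dFK_eq_zero_trans {x y z : X} (h : dFK T x y = 0) (h' : dFK T y z = 0) :
    dFK T x z = 0 := by
  rw [dFK_eq_zero_iff] at h h' ⊢
  intro δ hδ
  filter_upwards [h (δ / 2) (half_pos hδ), h' (δ / 2) (half_pos hδ)] with n hn hn'
  have h1 := maxMatch_triangle T n (δ / 2) (δ / 2) x y z
  rw [add_halves] at h1
  have h2 : (maxMatch T n (δ / 2) x y : ℝ) + maxMatch T n (δ / 2) y z ≤
      maxMatch T n δ x z + n := by exact_mod_cast h1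
  linarith

/-- Having a match with a prescribed graph is a finite conjunction of strict inequalities between
continuous functions; a union over graphs remains open. -/
theorem isOpen_le_maxMatch (hT : Continuous T) (n k : ℕ) (δ : ℝ) :
    IsOpen {p : X × X | k ≤ maxMatch T n δ p.1 p.2} := by
  have : {p : X × X | k ≤ maxMatch T n δ p.1 p.2} =
      ⋃ S ∈ {S : Finset (ℕ × ℕ) | IsOrderMatch (fun _ _ => True) n S ∧ k ≤ S.card},
        ⋂ s ∈ S, {p : X × X | dist (T^[s.1] p.1) (T^[s.2] p.2) < δ} := by
    ext p
    simp only [Set.mem_ofPred_eq, Set.mem_iUnion, Set.mem_iInter, maxMatch_eq_matchNum]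
    constructor
    · intro h
      obtain ⟨S, hS, hc⟩ :=
        exists_card_eq_matchNum (fun a b => dist (T^[a] p.1) (T^[b] p.2) < δ) n
      exact ⟨S, ⟨⟨fun s hs => ⟨(hS.1 s hs).1, (hS.1 s hs).2.1, trivial⟩, hS.2⟩, hc ▸ h⟩,
        fun s hs => (hS.1 s hs).2.2⟩
    · rintro ⟨S, ⟨hS, hc⟩, h⟩
      exact hc.trans (IsOrderMatch.card_le_matchNum
        ⟨fun s hs => ⟨(hS.1 s hs).1, (hS.1 s hs).2.1, h s hs⟩, hS.2⟩)
  rw [this]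
  refine isOpen_biUnion fun S _ => isOpen_biInter_finset fun s _ => ?_
  exact isOpen_lt (((hT.iterate _).comp continuous_fst).dist ((hT.iterate _).comp continuous_snd))
    continuous_const

variable [SecondCountableTopology X] [MeasurableSpace X] [BorelSpace X]

theorem measurable_maxMatch (hT : Continuous T) (n : ℕ) (δ : ℝ) :
    Measurable fun p : X × X => maxMatch T n δ p.1 p.2 :=
  measurable_of_Ici fun k => (isOpen_le_maxMatch hT n k δ).measurableSet

theorem measurable_fBarN (hT : Continuous T) (n : ℕ) (δ : ℝ) :
    Measurable fun p : X × X => fBarN T n δ p.1 p.2 :=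
  ((measurable_from_top.comp (measurable_maxMatch hT n δ)).div_const _).const_sub _

theorem measurableSet_dFK_eq_zero (hT : Continuous T) :
    MeasurableSet {p : X × X | dFK T p.1 p.2 = 0} := by
  simp only [dFK_eq_zero_iff_nat, eventually_atTop, Set.ofPred_forall, Set.ofPred_exists]
  refine MeasurableSet.iInter fun m => MeasurableSet.iUnion fun _ => MeasurableSet.iInter fun n =>
    MeasurableSet.iInter fun _ => ?_
  exact measurableSet_le measurable_const
    ((measurable_from_top (f := (Nat.cast : ℕ → ℝ))).comp (measurable_maxMatch hT n _))

end FeldmanKatokPseudometric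

end FeldmanKatok

/-! ### The maximal ergodic inequality -/

section MaximalErgodic

variable {α : Type*}

/-- The maximum of the Birkhoff sums of `f` of lengths `0, …, N`. -/
noncomputable def birkhoffMax (S : α → α) (f : α → ℝ) : ℕ → α → ℝ
  | 0 => 0
  | N + 1 => fun x => max 0 (f x + birkhoffMax S f N (S x))

theorem birkhoffMax_nonneg (S : α → α) (f : α → ℝ) (N : ℕ) (x : α) : 0 ≤ birkhoffMax S f N x := by
  cases N with
  | zero => exact le_rfl
  | succ N => exact le_max_left _ _

theorem birkhoffMax_le_succ (S : α → α) (f : α → ℝ) (N : ℕ) (x : α) :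
    birkhoffMax S f N x ≤ birkhoffMax S f (N + 1) x := by
  induction N generalizing x with
  | zero => exact birkhoffMax_nonneg S f 1 x
  | succ N ih => exact max_le_max le_rfl (by gcongr; exact ih (S x))

theorem birkhoffSum_le_birkhoffMax (S : α → α) (f : α → ℝ) (N : ℕ) (x : α) :
    birkhoffSum S f N x ≤ birkhoffMax S f N x := by
  induction N generalizing x with
  | zero => simp [birkhoffMax]
  | succ N ih =>
    rw [birkhoffSum_succ']
    exact le_max_of_le_right (by gcongr; exact ih (S x))

variable [MeasurableSpace α] {ν : Measure α} {S : α → α} {f : α → ℝ}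

theorem measurable_birkhoffMax (hS : Measurable S) (hf : Measurable f) (N : ℕ) :
    Measurable (birkhoffMax S f N) := by
  induction N with
  | zero => exact measurable_const
  | succ N ih => exact measurable_const.max (hf.add (ih.comp hS))

theorem integrable_birkhoffMax (hS : MeasurePreserving S ν ν) (hf : Integrable f ν) (N : ℕ) :
    Integrable (birkhoffMax S f N) ν := by
  induction N with
  | zero => exact integrable_zero _ _ _
  | succ N ih =>
    exact (integrable_zero _ _ _).sup (hf.add (hS.integrable_comp_of_integrable ih))

/-- **Maximal ergodic theorem** for finitely many Birkhoff sums. -/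
theorem setIntegral_birkhoffMax_pos_nonneg (hS : MeasurePreserving S ν ν)
    (hfm : Measurable f) (hf : Integrable f ν) (N : ℕ) :
    0 ≤ ∫ x in {x | 0 < birkhoffMax S f N x}, f x ∂ν := by
  have hmeas := measurable_birkhoffMax hS.measurable hfm
  cases N with
  | zero => simp [birkhoffMax]
  | succ N =>
    have hE : MeasurableSet {x | 0 < birkhoffMax S f (N + 1) x} :=
      measurableSet_lt measurable_const (hmeas _)
    have hcomp : Integrable (fun x => birkhoffMax S f N (S x)) ν :=
      hS.integrable_comp_of_integrable (integrable_birkhoffMax hS hf N)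
    -- Where the maximum is positive, the integrand equals `f`; elsewhere its first term vanishes
    -- and it is at most 0. By invariance the left integral is that of `birkhoffMax S f (N + 1) -
    -- birkhoffMax S f N`, which is nonnegative.
    have h1 : ∫ x, birkhoffMax S f (N + 1) x - birkhoffMax S f N (S x) ∂ν ≤
        ∫ x in {x | 0 < birkhoffMax S f (N + 1) x}, f x ∂ν := by
      rw [← integral_indicator hE]
      refine integral_mono ((integrable_birkhoffMax hS hf _).sub hcomp) (hf.indicator hE) fun x => ?_
      by_cases hx : 0 < birkhoffMax S f (N + 1) x
      · have : birkhoffMax S f (N + 1) x = f x + birkhoffMax S f N (S x) := by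
          rcases max_choice 0 (f x + birkhoffMax S f N (S x)) with h | h
          · exact absurd h hx.ne'
          · exact h
        simp [Set.indicator_of_mem (show x ∈ {x | 0 < birkhoffMax S f (N + 1) x} from hx), this]
      · have h0 := birkhoffMax_nonneg S f N (S x)
        rw [Set.indicator_of_notMem (show x ∉ {x | 0 < birkhoffMax S f (N + 1) x} from hx)]
        linarith [not_lt.1 hx]
    have h2 : ∫ x, birkhoffMax S f N (S x) ∂ν = ∫ x, birkhoffMax S f N x ∂ν := by
      rw [← integral_map hS.measurable.aemeasurable (hmeas N).aestronglyMeasurable, hS.map_eq]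
    rw [integral_sub (integrable_birkhoffMax hS hf _) hcomp, h2] at h1
    have h3 := integral_mono (integrable_birkhoffMax hS hf N) (integrable_birkhoffMax hS hf (N + 1))
      (birkhoffMax_le_succ S f N)
    linarith

/-- Weak type inequality for the ergodic maximal function of a nonnegative function. -/
theorem mul_measureReal_exists_lt_birkhoffSum_le [IsFiniteMeasure ν] (hS : MeasurePreserving S ν ν)
    {g : α → ℝ} (hgm : Measurable g) (hg : Integrable g ν) (hg0 : ∀ x, 0 ≤ g x) {a : ℝ}
    (ha : 0 ≤ a) :
    a * ν.real {x | ∃ q : ℕ, a * q < birkhoffSum S g q x} ≤ ∫ x, g x ∂ν := by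
  -- A Birkhoff sum of `g` above `a * q` is a positive Birkhoff sum of `g - a`.
  let f : α → ℝ := fun x => g x - a
  have hfm : Measurable f := hgm.sub_const a
  have hf : Integrable f ν := hg.sub (integrable_const a)
  have hsum : ∀ q x, birkhoffSum S f q x = birkhoffSum S g q x - a * q := by
    intro q x
    simp [birkhoffSum, f, Finset.sum_sub_distrib, mul_comm]
  let E : ℕ → Set α := fun N => {x | 0 < birkhoffMax S f N x}
  have hmono : Monotone E :=
    monotone_nat_of_le_succ fun N x hx => lt_of_lt_of_le hx (birkhoffMax_le_succ S f N x)
  have hEN : ∀ N, a * ν.real (E N) ≤ ∫ x, g x ∂ν := by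
    intro N
    have h1 := setIntegral_birkhoffMax_pos_nonneg hS hfm hf N
    change 0 ≤ ∫ x in E N, g x - a ∂ν at h1
    rw [integral_sub hg.integrableOn (integrable_const a), setIntegral_const, smul_eq_mul] at h1
    have h2 := setIntegral_le_integral (s := E N) hg (Eventually.of_forall hg0)
    linarith
  have hlim : Tendsto (fun N => a * ν.real (E N)) atTop (nhds (a * ν.real (⋃ N, E N))) :=
    ((ENNReal.tendsto_toReal (measure_ne_top _ _)).comp
      (tendsto_measure_iUnion_atTop hmono)).const_mul a
  refine le_trans ?_ (le_of_tendsto' hlim hEN)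
  refine mul_le_mul_of_nonneg_left (measureReal_mono ?_) ha
  rintro x ⟨q, hq⟩
  refine Set.mem_iUnion.2 ⟨q, lt_of_lt_of_le ?_ (birkhoffSum_le_birkhoffMax S f q x)⟩
  rw [hsum]
  linarith

end MaximalErgodic

namespace FeldmanKatok

/-! ### Edit distance, names and partitions -/

section EditDist

variable {α : Type*} {n : ℕ}

theorem editDist_le_iff (hn : 0 < n) {u v : Fin n → α} {ε : ℝ} :
    editDist u v ≤ ε ↔ (1 - ε) * n ≤ maxCommon u v := by
  have hn' : (0 : ℝ) < n := by exact_mod_cast hn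
  rw [← le_div_iff₀ hn', editDist]
  constructor <;> intro h <;> linarith

theorem editDist_triangle_left (hn : 0 < n) (w u v : Fin n → α) :
    editDist u v ≤ editDist w u + editDist w v := by
  have hn' : (0 : ℝ) < n := by exact_mod_cast hn
  have h : maxCommon w u + maxCommon w v ≤ maxCommon u v + n := by
    simp only [maxCommon_eq_matchNum]
    refine (Nat.add_le_add_right (matchNum_swap _ n) _).trans (matchNum_comp ?_)
    rintro a ha c hc b ⟨_, _, h1⟩ ⟨_, _, h2⟩
    exact ⟨ha, hc, h1.symm.trans h2⟩
  have h' : (maxCommon w u : ℝ) + maxCommon w v ≤ maxCommon u v + n := by exact_mod_cast h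
  have h2 := div_le_div_of_nonneg_right h' hn'.le
  rw [add_div, add_div, div_self hn'.ne'] at h2
  unfold editDist
  linarith

end EditDist

section Names

variable {X : Type*} (P : Finpartition (Set.univ : Set X))

theorem exists_mem_parts (x : X) : ∃ A : P.parts, x ∈ (A : Set X) := by
  have h : x ∈ P.parts.sup id := by rw [P.sup_parts]; trivial
  rw [Finset.sup_id_set_eq_sUnion] at h
  obtain ⟨A, hA, hx⟩ := h
  exact ⟨⟨A, hA⟩, hx⟩

theorem eq_of_mem_parts {A B : P.parts} {x : X} (hA : x ∈ (A : Set X)) (hB : x ∈ (B : Set X)) :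
    A = B := by
  by_contra h
  exact Set.disjoint_left.1 (P.disjoint A.2 B.2 fun h' => h (Subtype.ext h')) hA hB

/-- The element of the partition `P` that contains `x`. -/
noncomputable def partOf (x : X) : P.parts := (exists_mem_parts P x).choose

theorem mem_partOf (x : X) : x ∈ (partOf P x : Set X) := (exists_mem_parts P x).choose_spec

/-- The `n`-name of a point along the partition `P`. -/
noncomputable def name (T : X → X) (n : ℕ) (x : X) : Fin n → P.parts :=
  fun i => partOf P (T^[(i : ℕ)] x)

theorem mem_cylinder_iff {T : X → X} {n : ℕ} {w : Fin n → P.parts} {x : X} :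
    x ∈ cylinder T P w ↔ w = name P T n x := by
  simp only [cylinder, Set.mem_iInter, Set.mem_preimage, funext_iff]
  refine forall_congr' fun i => ⟨fun h => eq_of_mem_parts P h (mem_partOf P _), fun h => ?_⟩
  rw [h]
  exact mem_partOf P _

theorem mem_biUnion_cylinder_iff {T : X → X} {n : ℕ} {w : Fin n → P.parts} {x : X} {ε : ℝ} :
    x ∈ ⋃ w' ∈ {w' : Fin n → P.parts | editDist w w' < ε}, cylinder T P w' ↔
      editDist w (name P T n x) < ε := by
  simp [mem_cylinder_iff]

/-- The partition into the fibres of a measurable map with finitely many values. -/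
theorem exists_finpartition_of_measurable [MeasurableSpace X] {ι : Type*} [Finite ι]
    [MeasurableSpace ι] [MeasurableSingletonClass ι] {c : X → ι} (hc : Measurable c) :
    ∃ P : Finpartition (Set.univ : Set X), (∀ A ∈ P.parts, MeasurableSet A) ∧
      ∀ x y, partOf P x = partOf P y → c x = c y := by
  classical
  have := Fintype.ofFinite ι
  let parts : Finset (Set X) := Finset.univ.image fun i => c ⁻¹' {i}
  have hparts : ∀ A ∈ parts, ∃ i, A = c ⁻¹' {i} := by
    intro A hA
    obtain ⟨i, -, rfl⟩ := Finset.mem_image.1 hA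
    exact ⟨i, rfl⟩
  have hind : parts.SupIndep id := by
    rw [Finset.supIndep_iff_pairwiseDisjoint]
    intro A hA B hB hAB
    obtain ⟨i, rfl⟩ := hparts A hA
    obtain ⟨j, rfl⟩ := hparts B hB
    refine Disjoint.preimage c (Set.disjoint_singleton.2 ?_)
    rintro rfl
    exact hAB rfl
  have hsup : parts.sup id = Set.univ := by
    rw [Finset.sup_id_set_eq_sUnion, Set.eq_univ_iff_forall]
    exact fun x => ⟨c ⁻¹' {c x}, Finset.mem_image_of_mem _ (Finset.mem_univ _), rfl⟩
  -- Values that are not attained have empty fibres, which `ofErase` discards.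
  have hmem : ∀ A ∈ (Finpartition.ofErase parts hind hsup).parts, A ∈ parts :=
    fun A hA => Finset.mem_of_mem_erase hA
  refine ⟨Finpartition.ofErase parts hind hsup, fun A hA => ?_, fun x y hxy => ?_⟩
  · obtain ⟨i, rfl⟩ := hparts A (hmem A hA)
    exact hc (measurableSet_singleton i)
  · obtain ⟨i, hi⟩ := hparts _ (hmem _ (partOf (Finpartition.ofErase parts hind hsup) x).2)
    have hx := mem_partOf (Finpartition.ofErase parts hind hsup) x
    have hy := mem_partOf (Finpartition.ofErase parts hind hsup) y
    rw [← hxy] at hy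
    rw [hi] at hx hy
    exact hx.trans hy.symm

/-- A compact metric space has a finite measurable partition into sets of small diameter. -/
theorem exists_finpartition_dist_lt [MetricSpace X] [CompactSpace X] [MeasurableSpace X]
    [BorelSpace X] {δ : ℝ} (hδ : 0 < δ) :
    ∃ P : Finpartition (Set.univ : Set X), (∀ A ∈ P.parts, MeasurableSet A) ∧
      ∀ x y, partOf P x = partOf P y → dist x y < δ := by
  obtain ⟨t, -, ht, hcover⟩ :=
    finite_cover_balls_of_compact (isCompact_univ (X := X)) (half_pos hδ)
  have := ht.to_subtype
  -- Points are coloured by the set of balls of the finite cover containing them; equal colours mean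
  -- a common ball.
  have hc : Measurable fun x : X => fun z : t => x ∈ Metric.ball (z : X) (δ / 2) :=
    measurable_pi_lambda _ fun z => measurableSet_setOfPred.1 Metric.isOpen_ball.measurableSet
  obtain ⟨P, hP, h⟩ := exists_finpartition_of_measurable hc
  refine ⟨P, hP, fun x y hxy => ?_⟩
  obtain ⟨z, hz, hxz⟩ := Set.mem_iUnion₂.1 (hcover (Set.mem_univ x))
  have hyz : y ∈ Metric.ball z (δ / 2) := (congrFun (h x y hxy) ⟨z, hz⟩).mp hxz
  have := dist_triangle_right x y z
  have := Metric.mem_ball.1 hxz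
  have := Metric.mem_ball.1 hyz
  linarith

end Names

/-! ### Katok's condition implies ergodicity -/

section Katok

variable {X : Type*} [MeasurableSpace X] {T : X → X} {μ : Measure X}

theorem measurableSet_cylinder (hT : Measurable T) {P : Finpartition (Set.univ : Set X)}
    (hP : ∀ A ∈ P.parts, MeasurableSet A) {n : ℕ} (w : Fin n → P.parts) :
    MeasurableSet (cylinder T P w) :=
  MeasurableSet.iInter fun i => (hT.iterate i) (hP _ (w i).2)

/-- Passing through the central word doubles `ε`. A single length `n` is enough for all later uses
of Katok's condition. -/
theorem KatokCondition.exists_editDist_lt (h : KatokCondition T μ) (hT : Measurable T)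
    {P : Finpartition (Set.univ : Set X)} (hP : ∀ A ∈ P.parts, MeasurableSet A) {ε : ℝ}
    (hε : 0 < ε) :
    ∃ n : ℕ, 0 < n ∧ ∃ W : Set X, MeasurableSet W ∧ 1 - ε ≤ μ.real W ∧
      ∀ x ∈ W, ∀ y ∈ W, editDist (name P T n x) (name P T n y) < 2 * ε := by
  obtain ⟨N, hN⟩ := h P hP ε hε
  obtain ⟨w, hw⟩ := hN (N + 1) N.lt_succ_self
  refine ⟨N + 1, N.succ_pos, _, ?_, hw, fun x hx y hy => ?_⟩
  · exact MeasurableSet.biUnion (Set.to_countable _) fun w' _ => measurableSet_cylinder hT hP w'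
  · rw [mem_biUnion_cylinder_iff] at hx hy
    have := editDist_triangle_left N.succ_pos w (name P T (N + 1) x) (name P T (N + 1) y)
    linarith

theorem KatokCondition.ergodic [IsProbabilityMeasure μ] (h : KatokCondition T μ)
    (hμ : MeasurePreserving T μ μ) : Ergodic T μ := by
  refine ⟨hμ, ⟨fun A hA hTA => ?_⟩⟩
  rw [eventuallyConst_set]
  by_contra hcon
  obtain ⟨h1, h2⟩ := not_or.1 hcon
  have hA0 : 0 < μ.real A := by
    refine (measureReal_nonneg).lt_of_ne fun h0 => h2 ?_
    exact measure_eq_zero_iff_ae_notMem.1 ((measureReal_eq_zero_iff).1 h0.symm)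
  have hA1 : 0 < μ.real Aᶜ := by
    refine (measureReal_nonneg).lt_of_ne fun h0 => h1 ?_
    exact mem_ae_iff.2 ((measureReal_eq_zero_iff).1 h0.symm)
  have hc : Measurable fun x => x ∈ A := measurableSet_setOfPred.1 hA
  obtain ⟨P, hP, hPc⟩ := exists_finpartition_of_measurable hc
  have hsum := probReal_add_probReal_compl (μ := μ) hA
  -- With this `ε`, a set of measure at least `1 - ε` meets both `A` and `Aᶜ`, while `2 * ε < 1`.
  let ε := min (μ.real A) (μ.real Aᶜ) / 2
  have hε : 0 < ε := half_pos (lt_min hA0 hA1)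
  have hεA : ε < μ.real A := (half_lt_self (lt_min hA0 hA1)).trans_le (min_le_left _ _)
  have hεA' : ε < μ.real Aᶜ := (half_lt_self (lt_min hA0 hA1)).trans_le (min_le_right _ _)
  obtain ⟨n, hn, W, -, hWε, hW⟩ := h.exists_editDist_lt hμ.measurable hP hε
  have hmeet : ∀ B : Set X, MeasurableSet B → ε < μ.real B → (W ∩ B).Nonempty := by
    intro B hB hεB
    by_contra hne
    have hsub : W ⊆ Bᶜ := fun x hx hxB => hne ⟨x, hx, hxB⟩
    have h3 : μ.real W ≤ μ.real Bᶜ := measureReal_mono hsub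
    have h4 := probReal_add_probReal_compl (μ := μ) hB
    linarith
  obtain ⟨x, hxW, hxA⟩ := hmeet A hA hεA
  obtain ⟨y, hyW, hyA⟩ := hmeet Aᶜ hA.compl hεA'
  have hiter : ∀ (k : ℕ) (z : X), T^[k] z ∈ A ↔ z ∈ A := by
    intro k
    induction k with
    | zero => simp
    | succ k ih =>
      intro z
      rw [Function.iterate_succ_apply, ih]
      exact Set.ext_iff.1 hTA z
  -- One orbit stays in `A` and the other in `Aᶜ`, so the names share no letter.
  have h5 : maxCommon (name P T n x) (name P T n y) = 0 := by
    rw [maxCommon_eq_matchNum]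
    obtain ⟨S, hS, hcard⟩ := exists_card_eq_matchNum
      (fun a b => ∃ (ha : a < n) (hb : b < n), name P T n x ⟨a, ha⟩ = name P T n y ⟨b, hb⟩) n
    rw [← hcard, Finset.card_eq_zero, Finset.eq_empty_iff_forall_notMem]
    intro p hp
    obtain ⟨-, -, _, _, hab⟩ := hS.1 p hp
    have h6 := hPc _ _ hab
    rw [eq_iff_iff, hiter, hiter] at h6
    exact hyA (h6.1 hxA)
  have h7 := hW x hxW y hyW
  rw [editDist, h5, Nat.cast_zero, zero_div, sub_zero] at h7
  linarith

end Katok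

/-! ### From Katok's condition to zero distance for almost every pair -/

section ProductMeasure

variable {X : Type*} [MetricSpace X] [CompactSpace X] [MeasurableSpace X] [BorelSpace X]
  {T : X → X} {μ : Measure X} [IsProbabilityMeasure μ]

/-- Cells have diameter so small that equal letters give `δ`-close points, hence `fBarN` is at most
the edit distance of names. Pairs in `W ×ˢ W` contribute `2 * ε`, the others their measure. -/
theorem KatokCondition.exists_integral_fBarN_le (h : KatokCondition T μ) (hT : Continuous T)
    {δ ε : ℝ} (hδ : 0 < δ) (hε : 0 < ε) :
    ∃ n : ℕ, 0 < n ∧ ∫ p, fBarN T n δ p.1 p.2 ∂(μ.prod μ) ≤ 4 * ε := by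
  obtain ⟨P, hP, hPδ⟩ := exists_finpartition_dist_lt (X := X) hδ
  obtain ⟨n, hn, W, hWm, hWε, hW⟩ := h.exists_editDist_lt hT.measurable hP hε
  refine ⟨n, hn, ?_⟩
  have hle : ∀ x y : X, fBarN T n δ x y ≤ editDist (name P T n x) (name P T n y) := by
    intro x y
    have : maxCommon (name P T n x) (name P T n y) ≤ maxMatch T n δ x y := by
      rw [maxCommon_eq_matchNum, maxMatch_eq_matchNum]
      exact matchNum_mono le_rfl fun a _ b _ ⟨_, _, hab⟩ => hPδ _ _ hab
    have : (maxCommon (name P T n x) (name P T n y) : ℝ) ≤ maxMatch T n δ x y := by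
      exact_mod_cast this
    unfold fBarN editDist
    gcongr
  have hbound : ∀ p : X × X,
      fBarN T n δ p.1 p.2 ≤ 2 * ε + (W ×ˢ W)ᶜ.indicator (fun _ => (1 : ℝ)) p := by
    intro p
    by_cases hp : p ∈ W ×ˢ W
    · rw [Set.indicator_of_notMem (by simpa using hp)]
      linarith [hle p.1 p.2, hW _ hp.1 _ hp.2]
    · rw [Set.indicator_of_mem hp]
      linarith [fBarN_le_one T n δ p.1 p.2]
  have hWW : MeasurableSet (W ×ˢ W)ᶜ := (hWm.prod hWm).compl
  have hint : Integrable ((W ×ˢ W)ᶜ.indicator fun _ => (1 : ℝ)) (μ.prod μ) :=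
    (integrable_const 1).indicator hWW
  have h1 := integral_mono_of_nonneg (μ := μ.prod μ)
    (Eventually.of_forall fun p => fBarN_nonneg T n δ p.1 p.2)
    ((integrable_const (2 * ε)).add hint) (Eventually.of_forall hbound)
  refine h1.trans ?_
  have h2 : ∫ p, (W ×ˢ W)ᶜ.indicator (fun _ => (1 : ℝ)) p ∂(μ.prod μ) =
      1 - μ.real W * μ.real W := by
    rw [integral_indicator_const _ hWW, smul_eq_mul, mul_one, probReal_compl_eq_one_sub
      (hWm.prod hWm), measureReal_prod_prod]
  have h3 : ∫ p, (2 * ε + (W ×ˢ W)ᶜ.indicator (fun _ => (1 : ℝ)) p) ∂(μ.prod μ) =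
      2 * ε + (1 - μ.real W * μ.real W) := by
    rw [integral_add (integrable_const _) hint, h2, integral_const, probReal_univ, one_smul]
  refine h3.le.trans ?_
  -- `1 - w² ≤ 2 * (1 - w) ≤ 2 * ε` for `w = μ.real W`.
  nlinarith [measureReal_le_one (μ := μ) (s := W), measureReal_nonneg (μ := μ) (s := W)]

omit [CompactSpace X] [MeasurableSpace X] [BorelSpace X] in
/-- If all Birkhoff averages of `f̄_{n₀, δ}` along `(T × T)^{n₀}` are at most `a`, then
eventually `f̄_{n, δ} ≤ 2 a`. -/
theorem eventually_le_maxMatch_of_birkhoffSum_le {n₀ : ℕ} (hn₀ : 0 < n₀) {δ a : ℝ} (ha : 0 < a)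
    {p : X × X}
    (h : ∀ q : ℕ, birkhoffSum (Prod.map T T)^[n₀] (fun p => fBarN T n₀ δ p.1 p.2) q p ≤ a * q) :
    ∀ᶠ n : ℕ in atTop, (1 - 2 * a) * n ≤ maxMatch T n δ p.1 p.2 := by
  -- For such `n` the incomplete last block costs at most `a * n`; the full blocks cost another `a *
  -- n`.
  filter_upwards [eventually_ge_atTop ⌈n₀ / a⌉₊] with n hn
  have hn' : (n₀ : ℝ) ≤ a * n := by
    rw [← div_le_iff₀' ha]
    exact Nat.ceil_le.1 hn
  have h1 : (maxMatch T (n₀ * (n / n₀)) δ p.1 p.2 : ℝ) ≤ maxMatch T n δ p.1 p.2 := by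
    exact_mod_cast maxMatch_mono (Nat.mul_div_le n n₀) le_rfl _ _
  have h2 : (∑ j ∈ Finset.range (n / n₀),
      (maxMatch T n₀ δ (T^[n₀ * j] p.1) (T^[n₀ * j] p.2) : ℝ)) ≤
        maxMatch T (n₀ * (n / n₀)) δ p.1 p.2 := by
    exact_mod_cast sum_maxMatch_le T n₀ (n / n₀) δ p.1 p.2
  have h3 : (∑ j ∈ Finset.range (n / n₀),
      (maxMatch T n₀ δ (T^[n₀ * j] p.1) (T^[n₀ * j] p.2) : ℝ)) =
        n₀ * (n / n₀ : ℕ) - n₀ *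
          birkhoffSum (Prod.map T T)^[n₀] (fun p => fBarN T n₀ δ p.1 p.2) (n / n₀) p := by
    simp only [birkhoffSum, ← Function.iterate_mul, Prod.map_iterate, Prod.map_fst, Prod.map_snd,
      Finset.mul_sum, mul_fBarN, Finset.sum_sub_distrib, Finset.sum_const, Finset.card_range,
      nsmul_eq_mul]
    ring
  have h4 : (n : ℝ) ≤ n₀ * (n / n₀ : ℕ) + n₀ := by
    have h5 := Nat.div_add_mod n n₀
    have h6 := Nat.mod_lt n hn₀
    have h7 : n ≤ n₀ * (n / n₀) + n₀ := by omega
    exact_mod_cast h7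
  have h8 : (n₀ : ℝ) * (n / n₀ : ℕ) ≤ n := by exact_mod_cast Nat.mul_div_le n n₀
  have h9 := mul_le_mul_of_nonneg_left (h (n / n₀)) (Nat.cast_nonneg (α := ℝ) n₀)
  have h10 := mul_le_mul_of_nonneg_left h8 ha.le
  linarith

theorem KatokCondition.ae_eventually_le_maxMatch (h : KatokCondition T μ) (hT : Continuous T)
    (hμ : MeasurePreserving T μ μ) {δ a : ℝ} (hδ : 0 < δ) (ha : 0 < a) :
    ∀ᵐ p ∂(μ.prod μ), ∀ᶠ n : ℕ in atTop, (1 - 2 * a) * n ≤ maxMatch T n δ p.1 p.2 := by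
  rw [ae_iff, ← measureReal_eq_zero_iff]
  refine le_antisymm (le_of_forall_pos_le_add fun ε hε => ?_) measureReal_nonneg
  -- The integral is then at most `a * ε`, and the maximal inequality at level `a` leaves an
  -- exceptional set of measure at most `ε`.
  obtain ⟨n₀, hn₀, hint⟩ := h.exists_integral_fBarN_le hT (μ := μ) hδ
    (show 0 < a * ε / 4 by positivity)
  have hmeas := measurable_fBarN hT n₀ δ
  have hintegrable : Integrable (fun p : X × X => fBarN T n₀ δ p.1 p.2) (μ.prod μ) := by
    refine Integrable.of_bound hmeas.aestronglyMeasurable 1 (Eventually.of_forall fun p => ?_)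
    rw [Real.norm_of_nonneg (fBarN_nonneg T n₀ δ p.1 p.2)]
    exact fBarN_le_one T n₀ δ p.1 p.2
  have hmax := mul_measureReal_exists_lt_birkhoffSum_le ((hμ.prod hμ).iterate n₀) hmeas hintegrable
    (fun p => fBarN_nonneg T n₀ δ p.1 p.2) ha.le
  have hsub : {p : X × X | ¬ ∀ᶠ n : ℕ in atTop, (1 - 2 * a) * n ≤ maxMatch T n δ p.1 p.2} ⊆
      {p | ∃ q : ℕ, a * q <
        birkhoffSum (Prod.map T T)^[n₀] (fun p => fBarN T n₀ δ p.1 p.2) q p} := by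
    intro p hp
    by_contra hq
    refine hp (eventually_le_maxMatch_of_birkhoffSum_le hn₀ ha fun q => not_lt.1 fun hlt => ?_)
    exact hq ⟨q, hlt⟩
  have h1 := mul_le_mul_of_nonneg_left (measureReal_mono (μ := μ.prod μ) hsub) ha.le
  rw [zero_add]
  exact le_of_mul_le_mul_left (by linarith) ha

theorem KatokCondition.prod_dFK_eq_zero (h : KatokCondition T μ) (hT : Continuous T)
    (hμ : MeasurePreserving T μ μ) : (μ.prod μ) {p : X × X | dFK T p.1 p.2 = 0} = 1 := by
  rw [← mem_ae_iff_prob_eq_one (measurableSet_dFK_eq_zero hT)]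
  have : ∀ᵐ p ∂(μ.prod μ), ∀ m : ℕ, ∀ᶠ n : ℕ in atTop,
      (1 - 1 / ((m : ℝ) + 1)) * n ≤ maxMatch T n (1 / ((m : ℝ) + 1)) p.1 p.2 := by
    refine ae_all_iff.2 fun m => ?_
    have hm : (0 : ℝ) < 1 / ((m : ℝ) + 1) := by positivity
    simpa only [mul_div_cancel₀ _ (two_ne_zero' ℝ), mul_div_cancel_left₀] using
      h.ae_eventually_le_maxMatch hT hμ hm (half_pos hm)
  filter_upwards [this] with p hp
  exact dFK_eq_zero_iff_nat.2 hp

theorem exists_measurableSet_of_prod_dFK_eq_zero (hT : Continuous T)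
    (h : (μ.prod μ) {p : X × X | dFK T p.1 p.2 = 0} = 1) :
    ∃ M : Set X, MeasurableSet M ∧ μ M = 1 ∧ ∀ x ∈ M, ∀ y ∈ M, dFK T x y = 0 := by
  have hmeas := measurableSet_dFK_eq_zero hT
  rw [← mem_ae_iff_prob_eq_one hmeas] at h
  obtain ⟨x, hx⟩ := (Measure.ae_ae_of_ae_prod h).exists
  have hM : MeasurableSet {y | dFK T x y = 0} := measurable_prodMk_left hmeas
  exact ⟨_, hM, (mem_ae_iff_prob_eq_one hM).1 hx,
    fun y hy z hz => dFK_eq_zero_trans (dFK_eq_zero_symm hy) hz⟩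

end ProductMeasure

/-! ### From zero distance on a set of full measure to Katok's condition -/

section CompactApproximation

variable {X : Type*} [MetricSpace X] [CompactSpace X] [MeasurableSpace X] [BorelSpace X]
  {T : X → X} {μ : Measure X} [IsProbabilityMeasure μ]

/-- Up to a set of small measure, nearby points lie in the same element of a partition. -/
theorem exists_isCompact_partOf_eq {P : Finpartition (Set.univ : Set X)}
    (hP : ∀ A ∈ P.parts, MeasurableSet A) {η : ℝ} (hη : 0 < η) :
    ∃ K : Set X, IsCompact K ∧ μ.real Kᶜ ≤ η ∧
      ∃ δ : ℝ, 0 < δ ∧ ∀ x ∈ K, ∀ y ∈ K, dist x y < δ → partOf P x = partOf P y := by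
  let c : ℝ := η / (Fintype.card P.parts + 1)
  have hc : 0 < c := by positivity
  have hex : ∀ A : P.parts, ∃ K ⊆ (A : Set X), IsCompact K ∧
      μ ((A : Set X) \ K) < ENNReal.ofReal c := fun A =>
    (hP _ A.2).exists_isCompact_sdiff_lt (measure_ne_top _ _) (ENNReal.ofReal_pos.2 hc).ne'
  choose K hKA hK hKc using hex
  -- Disjoint compact sets are at positive distance; finitely many pairs then share one `δ`.
  have hsep : ∀ A B : P.parts, A ≠ B → ∃ δ : ℝ, 0 < δ ∧ ∀ x ∈ K A, ∀ y ∈ K B, δ ≤ dist x y := by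
    intro A B hAB
    have hdisj : Disjoint (K A) (K B) :=
      (P.disjoint A.2 B.2 fun h => hAB (Subtype.ext h)).mono (hKA A) (hKA B)
    obtain ⟨δ, hδ, h⟩ := hdisj.exists_thickenings (hK A) (hK B).isClosed
    refine ⟨δ, hδ, fun x hx y hy => not_lt.1 fun hlt => ?_⟩
    exact Set.disjoint_left.1 h
      (Metric.mem_thickening_iff.2 ⟨x, hx, by rwa [dist_comm]⟩)
      (Metric.self_subset_thickening hδ _ hy)
  have hδ : ∃ δ : ℝ, 0 < δ ∧ ∀ A B : P.parts, A ≠ B → ∀ x ∈ K A, ∀ y ∈ K B, δ ≤ dist x y := by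
    have : ∀ᶠ δ in nhdsWithin (0 : ℝ) (Set.Ioi 0),
        ∀ A B : P.parts, A ≠ B → ∀ x ∈ K A, ∀ y ∈ K B, δ ≤ dist x y := by
      refine eventually_all.2 fun A => eventually_all.2 fun B => ?_
      by_cases hAB : A = B
      · exact Eventually.of_forall fun _ h => absurd hAB h
      · obtain ⟨δ, hδ, h⟩ := hsep A B hAB
        filter_upwards [Ioo_mem_nhdsGT hδ] with δ' hδ' _ x hx y hy
        exact hδ'.2.le.trans (h x hx y hy)
    obtain ⟨δ, h, hδ⟩ := (this.and self_mem_nhdsWithin).exists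
    exact ⟨δ, hδ, h⟩
  obtain ⟨δ, hδ, hdist⟩ := hδ
  refine ⟨⋃ A, K A, isCompact_iUnion hK, ?_, δ, hδ, fun x hx y hy hxy => ?_⟩
  · have hsub : (⋃ A, K A)ᶜ ⊆ ⋃ A : P.parts, (A : Set X) \ K A := fun x hx =>
      Set.mem_iUnion.2 ⟨partOf P x, mem_partOf P x, fun h => hx (Set.mem_iUnion.2 ⟨_, h⟩)⟩
    calc μ.real (⋃ A, K A)ᶜ ≤ μ.real (⋃ A : P.parts, (A : Set X) \ K A) := measureReal_mono hsub
      _ ≤ ∑ A : P.parts, μ.real ((A : Set X) \ K A) := measureReal_iUnion_fintype_le _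
      _ ≤ ∑ _A : P.parts, c := Finset.sum_le_sum fun A _ =>
          ENNReal.toReal_le_of_le_ofReal hc.le (hKc A).le
      _ = Fintype.card P.parts * c := by simp
      _ ≤ (Fintype.card P.parts + 1) * c := by gcongr; linarith
      _ = η := mul_div_cancel₀ _ (by positivity)
  · obtain ⟨A, hA⟩ := Set.mem_iUnion.1 hx
    obtain ⟨B, hB⟩ := Set.mem_iUnion.1 hy
    have hAB : A = B := by
      by_contra hAB
      exact (hdist A B hAB x hA y hB).not_gt hxy
    subst hAB
    exact (eq_of_mem_parts P (mem_partOf P x) (hKA A hA)).trans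
      (eq_of_mem_parts P (mem_partOf P y) (hKA A hB)).symm

/-- Continuity from below, as in Egorov's theorem: a matching time depending on `y` becomes uniform
off a small set. -/
theorem exists_measureReal_compl_matched_le (hT : Continuous T) {M : Set X} (hM : μ M = 1)
    {x₀ : X} (h : ∀ y ∈ M, dFK T x₀ y = 0) {δ η : ℝ} (hδ : 0 < δ) (hη : 0 < η) :
    ∃ N : ℕ, μ.real {y | ∀ n ≥ N, (1 - δ) * n ≤ maxMatch T n δ x₀ y}ᶜ ≤ η := by
  let E : ℕ → Set X := fun N => {y | ∀ n ≥ N, (1 - δ) * n ≤ maxMatch T n δ x₀ y}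
  have hEm : ∀ N, MeasurableSet (E N) := by
    intro N
    simp only [E, Set.ofPred_forall]
    refine MeasurableSet.iInter fun n => MeasurableSet.iInter fun _ => ?_
    exact measurableSet_le measurable_const ((measurable_from_top (f := (Nat.cast : ℕ → ℝ))).comp
      ((measurable_maxMatch hT n δ).comp measurable_prodMk_left))
  have hmono : Monotone E := fun N N' hN y hy n hn => hy n (hN.trans hn)
  have hunion : μ (⋃ N, E N) = 1 := by
    refine le_antisymm prob_le_one (hM ▸ measure_mono fun y hy => ?_)
    obtain ⟨N, hN⟩ := eventually_atTop.1 (dFK_eq_zero_iff.1 (h y hy) δ hδ)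
    exact Set.mem_iUnion.2 ⟨N, hN⟩
  have hlim := tendsto_measure_iUnion_atTop (μ := μ) hmono
  rw [hunion] at hlim
  have hlim' : Tendsto (fun N => μ.real (E N)) atTop (nhds 1) :=
    (ENNReal.tendsto_toReal ENNReal.one_ne_top).comp hlim
  obtain ⟨N, hN⟩ := (hlim'.eventually (eventually_ge_nhds (show 1 - η < 1 by linarith))).exists
  refine ⟨N, ?_⟩
  change μ.real (E N)ᶜ ≤ η
  rw [probReal_compl_eq_one_sub (hEm N)]
  linarith

theorem katokCondition_of_forall_dFK_eq_zero (hT : Continuous T) (hμ : MeasurePreserving T μ μ)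
    {M : Set X} (hM : μ M = 1) (h : ∀ x ∈ M, ∀ y ∈ M, dFK T x y = 0) : KatokCondition T μ := by
  classical
  intro P hP ε hε
  obtain ⟨x₀, hx₀⟩ : M.Nonempty := by
    rw [Set.nonempty_iff_ne_empty]
    rintro rfl
    simp at hM
  -- The loss is `4 * η`: one `η` for each match with `x₀` and one for each orbit's exits from `K`.
  -- The bound `4 * η < 2` makes the good set nonempty.
  obtain ⟨η, hη, hηε, hη1⟩ : ∃ η : ℝ, 0 < η ∧ 4 * η < ε ∧ 4 * η < 2 :=
    ⟨min ε 2 / 8, by positivity, by linarith [min_le_left ε 2], by linarith [min_le_right ε 2]⟩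
  obtain ⟨K, hK, hKη, δ₀, hδ₀, hKδ⟩ :=
    -- The square survives division by the level `η` in the maximal inequality.
    exists_isCompact_partOf_eq (μ := μ) hP (show 0 < η * η by positivity)
  -- Composing two `δ`-matches through `x₀` yields distances below `δ + δ`.
  obtain ⟨δ, hδ, hδη, hδδ₀⟩ : ∃ δ : ℝ, 0 < δ ∧ δ ≤ η ∧ δ + δ ≤ δ₀ :=
    ⟨min η (δ₀ / 2), by positivity, min_le_left _ _, by linarith [min_le_right η (δ₀ / 2)]⟩
  obtain ⟨N, hN⟩ := exists_measureReal_compl_matched_le hT hM (h x₀ hx₀) hδ hη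
  have hKm : MeasurableSet Kᶜ := hK.measurableSet.compl
  let g : X → ℝ := Kᶜ.indicator fun _ => 1
  have hmax := mul_measureReal_exists_lt_birkhoffSum_le hμ (g := g)
    (measurable_const.indicator hKm) ((integrable_const 1).indicator hKm)
    (fun x => Set.indicator_nonneg (fun _ _ => zero_le_one) x) hη.le
  have hgint : ∫ x, g x ∂μ = μ.real Kᶜ := by
    rw [integral_indicator_const _ hKm, smul_eq_mul, mul_one]
  rw [hgint] at hmax
  have hmax' := le_of_mul_le_mul_left (hmax.trans hKη) hη
  have hsum : ∀ n x, birkhoffSum T g n x =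
      (((Finset.range n).filter fun i => ¬ T^[i] x ∈ K).card : ℝ) := by
    intro n x
    simp only [birkhoffSum, g, Finset.card_filter, Nat.cast_sum]
    refine Finset.sum_congr rfl fun i _ => ?_
    by_cases hi : T^[i] x ∈ K <;> simp [hi]
  let B : Set X := {y | ∀ n ≥ N, (1 - δ) * n ≤ maxMatch T n δ x₀ y}ᶜ ∪
    {x | ∃ q : ℕ, η * q < birkhoffSum T g q x}
  have hB : μ.real B ≤ 2 * η := (measureReal_union_le _ _).trans (by linarith)
  have hgood : 1 - 2 * η ≤ μ.real Bᶜ := by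
    have h1 := measureReal_union_le (μ := μ) B Bᶜ
    rw [Set.union_compl_self, probReal_univ] at h1
    linarith
  -- The central word is the name of a good point `x`, not of `x₀`, whose orbit may leave `K` often.
  obtain ⟨x, hx⟩ : (Bᶜ).Nonempty := by
    rw [Set.nonempty_iff_ne_empty]
    intro h0
    rw [h0, measureReal_empty] at hgood
    linarith
  have hmatch : ∀ z ∈ Bᶜ, ∀ n ≥ N, (1 - δ) * n ≤ maxMatch T n δ x₀ z := fun z hz =>
    not_not.1 fun hz' => hz (Or.inl hz')
  have hvisit : ∀ z ∈ Bᶜ, ∀ n : ℕ,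
      (((Finset.range n).filter fun i => ¬ T^[i] z ∈ K).card : ℝ) ≤ η * n := fun z hz n =>
    hsum n z ▸ not_lt.1 fun hlt => hz (Or.inr ⟨n, hlt⟩)
  refine ⟨N, fun n hn => ⟨name P T n x, ?_⟩⟩
  have hn0 : 0 < n := by omega
  refine le_trans (by linarith)
    (hgood.trans (measureReal_mono (fun y hy => ?_) (measure_ne_top _ _)))
  rw [mem_biUnion_cylinder_iff]
  refine lt_of_le_of_lt ((editDist_le_iff hn0).2 ?_) hηε
  have h1 := maxMatch_triangle T n δ δ x x₀ y
  rw [maxMatch_comm T n δ x x₀] at h1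
  have h2 : maxMatch T n (δ + δ) x y ≤ maxCommon (name P T n x) (name P T n y) +
      ((Finset.range n).filter fun i => ¬ T^[i] x ∈ K).card +
        ((Finset.range n).filter fun i => ¬ T^[i] y ∈ K).card := by
    rw [maxMatch_eq_matchNum, maxCommon_eq_matchNum]
    refine (matchNum_restrict _ n (fun i => T^[i] x ∈ K) fun i => T^[i] y ∈ K).trans ?_
    gcongr
    exact matchNum_mono le_rfl fun a ha b hb ⟨hab, haK, hbK⟩ =>
      ⟨ha, hb, hKδ _ haK _ hbK (hab.trans_le hδδ₀)⟩
  have h3 : (maxMatch T n δ x₀ x : ℝ) + maxMatch T n δ x₀ y ≤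
      maxCommon (name P T n x) (name P T n y) +
      ((Finset.range n).filter fun i => ¬ T^[i] x ∈ K).card +
        ((Finset.range n).filter fun i => ¬ T^[i] y ∈ K).card + n := by
    exact_mod_cast h1.trans (Nat.add_le_add_right h2 n)
  have h4 := hmatch x hx n hn.le
  have h5 := hmatch y hy n hn.le
  have h6 := hvisit x hx n
  have h7 := hvisit y hy n
  have h8 := mul_le_mul_of_nonneg_right hδη (Nat.cast_nonneg (α := ℝ) n)
  linarith

end CompactApproximation

end FeldmanKatok

/-! ### The equivalence and ergodicity -/

theorem theorem4p2 {X : Type*} [MetricSpace X] [CompactSpace X] [MeasurableSpace X] [BorelSpace X]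
    (T : X → X) (hT : Continuous T) (μ : Measure X) [IsProbabilityMeasure μ]
    (hμ : MeasurePreserving T μ μ) :
    List.TFAE [
      (μ.prod μ) {p : X × X | FeldmanKatok.dFK T p.1 p.2 = 0} = 1,
      ∃ M : Set X, MeasurableSet M ∧ μ M = 1 ∧ ∀ x ∈ M, ∀ y ∈ M, FeldmanKatok.dFK T x y = 0,
      FeldmanKatok.KatokCondition T μ] ∧
    ((μ.prod μ) {p : X × X | FeldmanKatok.dFK T p.1 p.2 = 0} = 1 → Ergodic T μ) ∧
    ((∃ M : Set X, MeasurableSet M ∧ μ M = 1 ∧ ∀ x ∈ M, ∀ y ∈ M, FeldmanKatok.dFK T x y = 0) →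
      Ergodic T μ) ∧
    (FeldmanKatok.KatokCondition T μ → Ergodic T μ) := by
  have h12 := FeldmanKatok.exists_measurableSet_of_prod_dFK_eq_zero (T := T) (μ := μ) hT
  have h23 : (∃ M : Set X, MeasurableSet M ∧ μ M = 1 ∧
      ∀ x ∈ M, ∀ y ∈ M, FeldmanKatok.dFK T x y = 0) → FeldmanKatok.KatokCondition T μ :=
    fun ⟨_, _, hM, h⟩ => FeldmanKatok.katokCondition_of_forall_dFK_eq_zero hT hμ hM h
  refine ⟨?_, fun h => (h23 (h12 h)).ergodic hμ, fun h => (h23 h).ergodic hμ,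
    fun h => h.ergodic hμ⟩
  tfae_have 1 → 2 := h12
  tfae_have 2 → 3 := h23
  tfae_have 3 → 1 := fun h => h.prod_dFK_eq_zero hT hμ
  tfae_finish
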